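/- For $n \in \mathbb{N}$, positive integers $k_1 \le \dots \le k_n$, ${\bf k} := (k_1,\dots,k_n)$ and $1 \le r \le n$, let $\mathcal{L}_{{\bf k},r}$ be the family of all sets $\{(x,y_x) : x \in X\}$ where $X$ is an $r$-element subset of $\{1,\dots,n\}$ and $y_x \in \{1,\dots,k_x\}$ for each $x \in X$. For a finite family $\mathcal{F}$ of finite sets and a set $S$, let $\mathcal{F}(S) := \{F \in \mathcal{F} : S \subseteq F\}$. A $t$-star of $\mathcal{F}$ is a family $\mathcal{F}(T)$ where $T$ is a $t$-element subset of some member of $\mathcal{F}$. A non-empty family $\mathcal{A}$ is $t$-intersecting if $|A \cap B| \ge t$ for all $A, B \in \mathcal{A}$ (including $A = B$). A $t$-intersecting sub-family of $\mathcal{F}$ is largest if no $t$-intersecting sub-family of $\mathcal{F}$ has more members. $\mathcal{F}$ has the $t$-star property at a $t$-element set $T$ if $\mathcal{F}(T)$ is a largest $t$-intersecting sub-family of $\mathcal{F}$. $\mathcal{F}$ has the strict $t$-star property if either $\mathcal{F}$ has no $t$-intersecting sub-family or every largest $t$-intersecting sub-family of $\mathcal{F}$ is a $t$-star of $\mathcal{F}$.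 Theorem. Let $1 \le t \le r$ and let $n \ge (r-t)\binom{3r-2t-1}{t+1} + r$. Let $1 \le k_1 \le \dots \le k_n$ be integers and let ${\bf k} := (k_1,\dots,k_n)$. Then: (i) $\mathcal{L}_{{\bf k},r}$ has the $t$-star property at $\{(1,1),\dots,(t,1)\}$; (ii) $\mathcal{L}_{{\bf k},r}$ has the strict $t$-star property. -/

import Mathlib

namespace LabeledSets

section Families

variable {α : Type*} [DecidableEq α]

/-- `𝓕(S)`: the members of the family `𝓕` that contain `S`. -/
def starOf (F : Finset (Finset α)) (S : Finset α) : Finset (Finset α) :=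
  F.filter (fun A => S ⊆ A)

/-- `𝓐` is a `t`-star of `𝓕`: `𝓐 = 𝓕(T)` for some `t`-element subset `T` of a member of `𝓕`. -/
def IsTStar (F : Finset (Finset α)) (t : ℕ) (A : Finset (Finset α)) : Prop :=
  ∃ T : Finset α, T.card = t ∧ (∃ B ∈ F, T ⊆ B) ∧ A = starOf F T

/-- `𝓐` is `t`-intersecting: any two (not necessarily distinct) members share at least `t`
elements. The empty family is not counted, so that a family has no `t`-intersecting
sub-families exactly when all its members have fewer than `t` elements. -/
def IsTIntersecting (t : ℕ) (A : Finset (Finset α)) : Prop :=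
  A.Nonempty ∧ ∀ B ∈ A, ∀ C ∈ A, t ≤ (B ∩ C).card

/-- `𝓐` is a largest `t`-intersecting sub-family of `𝓕`. -/
def IsLargestTIntersecting (F : Finset (Finset α)) (t : ℕ) (A : Finset (Finset α)) : Prop :=
  (A ⊆ F ∧ IsTIntersecting t A) ∧
    ∀ B : Finset (Finset α), B ⊆ F → IsTIntersecting t B → B.card ≤ A.card

/-- `𝓕` has the `t`-star property at `T`. -/
def HasTStarPropertyAt (F : Finset (Finset α)) (t : ℕ) (T : Finset α) : Prop :=
  T.card = t ∧ IsLargestTIntersecting F t (starOf F T)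

/-- `𝓕` has the strict `t`-star property. -/
def HasStrictTStarProperty (F : Finset (Finset α)) (t : ℕ) : Prop :=
  (¬ ∃ A : Finset (Finset α), A ⊆ F ∧ IsTIntersecting t A) ∨
    ∀ A : Finset (Finset α), IsLargestTIntersecting F t A → IsTStar F t A

end Families

/-- The family `𝓛_{k,r}` of labeled `r`-sets for `k = (k 1, …, k n)`: all sets
`{(x, y x) : x ∈ X}` with `X` an `r`-element subset of `{1, …, n}` and `y x ∈ {1, …, k x}` for
each `x ∈ X`. Values of `k` outside `{1, …, n}` play no role. -/
def labeledSets (n : ℕ) (k : ℕ → ℕ) (r : ℕ) : Finset (Finset (ℕ × ℕ)) :=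
  ((Finset.Icc 1 n).powersetCard r).biUnion fun X =>
    (X.pi fun x => Finset.Icc 1 (k x)).image fun y =>
      X.attach.image fun x => (x.1, y x.1 x.2)

theorem mem_labeledSets {n : ℕ} {k : ℕ → ℕ} {r : ℕ} {A : Finset (ℕ × ℕ)} :
    A ∈ labeledSets n k r ↔ ∃ X : Finset ℕ, X ⊆ Finset.Icc 1 n ∧ X.card = r ∧
      ∃ y : ℕ → ℕ, (∀ x ∈ X, y x ∈ Finset.Icc 1 (k x)) ∧ A = X.image fun x => (x, y x) := by
  simp only [labeledSets, Finset.mem_biUnion, Finset.mem_powersetCard, Finset.mem_image,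
    Finset.mem_pi]
  constructor
  · rintro ⟨X, ⟨hX, hr⟩, y, hy, rfl⟩
    refine ⟨X, hX, hr, fun x => if h : x ∈ X then y x h else 0, ?_, ?_⟩
    · intro x hx
      simpa [hx] using hy x hx
    · ext p
      simp only [Finset.mem_image, Finset.mem_attach, true_and, Subtype.exists]
      constructor
      · rintro ⟨x, hx, rfl⟩
        exact ⟨x, hx, by simp [hx]⟩
      · rintro ⟨x, hx, rfl⟩
        exact ⟨x, hx, by simp [hx]⟩
  · rintro ⟨X, hX, hr, y, hy, rfl⟩
    refine ⟨X, ⟨hX, hr⟩, fun x _ => y x, hy, ?_⟩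
    ext p
    simp

end LabeledSets

/-!
A non-trivial `t`-intersecting family of `r`-sets admits a set `J` with at most `3r - 2t - 1`
elements that meets each of its members in at least `t + 1` elements: two members `A`, `B` with
`|A ∩ B| = t` and a third member `C` not containing `A ∩ B` give `J = A ∪ B ∪ C`. By pigeonhole the
family is then at most `(3r - 2t - 1).choose (t + 1)` times as large as some `(t + 1)`-star.

A labeled set is a rainbow subset of the pairs `(x, y)`, the color of a pair being its position `x`.
Among rainbow `r`-sets with `n` colors, double counting shows that a `(t + 1)`-star is smaller than
some `t`-star by a factor of at least `(n + 1 - r) / (r - t)`, and a `t`-star is largest when its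
center uses the `t` smallest colors.
-/

namespace LabeledSets

open Finset

section Families

variable {α : Type*} [DecidableEq α] {F 𝒜 : Finset (Finset α)} {A B C D T T₀ : Finset α} {m r t : ℕ}

theorem mem_starOf : A ∈ starOf F T ↔ A ∈ F ∧ T ⊆ A := mem_filter

theorem starOf_subset : starOf F T ⊆ F := filter_subset _ _

theorem isTIntersecting_starOf (hne : (starOf F T).Nonempty) : IsTIntersecting #T (starOf F T) :=
  ⟨hne, fun _ hB _ hC => card_le_card (subset_inter (mem_starOf.1 hB).2 (mem_starOf.1 hC).2)⟩

theorem succ_le_card_inter_union (hAB : #(A ∩ B) ≤ t) (hD : ¬A ∩ B ⊆ D) (hA : t ≤ #(D ∩ A))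
    (hB : t ≤ #(D ∩ B)) : t + 1 ≤ #(D ∩ (A ∪ B)) := by
  have hlt : #(D ∩ A ∩ (D ∩ B)) < #(A ∩ B) := by
    rw [← inter_inter_distrib_left]
    exact card_lt_card ⟨inter_subset_right, fun h => hD (h.trans inter_subset_left)⟩
  have hsum := card_union_add_card_inter (D ∩ A) (D ∩ B)
  rw [← inter_union_distrib_left] at hsum
  omega

theorem succ_le_card_inter_union_union (hAB : #(A ∩ B) ≤ t) (hC : ¬A ∩ B ⊆ C)
    (hDA : t ≤ #(D ∩ A)) (hDB : t ≤ #(D ∩ B)) (hDC : t ≤ #(D ∩ C)) :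
    t + 1 ≤ #(D ∩ (A ∪ B ∪ C)) := by
  by_cases hD : A ∩ B ⊆ D
  · have hssub : D ∩ C ⊂ D ∩ C ∪ A ∩ B :=
      Finset.ssubset_iff_subset_ne.2 ⟨subset_union_left, fun h =>
        hC ((union_eq_left.1 h.symm).trans inter_subset_right)⟩
    calc t + 1 ≤ #(D ∩ C ∪ A ∩ B) := hDC.trans_lt (card_lt_card hssub)
      _ ≤ #(D ∩ (A ∪ B ∪ C)) := card_le_card (by grind)
  · exact (succ_le_card_inter_union hAB hD hDA hDB).trans
      (card_le_card (inter_subset_inter_left subset_union_left))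

theorem IsTIntersecting.exists_card_le_forall_succ_le_card_inter (h𝒜 : IsTIntersecting t 𝒜)
    (hr : (𝒜 : Set (Finset α)).Sized r) (hT : ∀ T : Finset α, #T = t → ∃ A ∈ 𝒜, ¬T ⊆ A) :
    ∃ J : Finset α, #J ≤ 3 * r - 2 * t - 1 ∧ ∀ A ∈ 𝒜, t + 1 ≤ #(A ∩ J) := by
  obtain ⟨⟨A₀, hA₀⟩, hint⟩ := h𝒜
  by_cases hbig : ∀ A ∈ 𝒜, ∀ B ∈ 𝒜, t + 1 ≤ #(A ∩ B)
  · have htr := hbig A₀ hA₀ A₀ hA₀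
    rw [inter_self, hr hA₀] at htr
    exact ⟨A₀, by rw [hr hA₀]; omega, fun A hA => hbig A hA A₀ hA₀⟩
  push Not at hbig
  obtain ⟨A, hA, B, hB, hlt⟩ := hbig
  have hAB : #(A ∩ B) = t := le_antisymm (Nat.le_of_lt_succ hlt) (hint A hA B hB)
  obtain ⟨C, hC, hABC⟩ := hT _ hAB
  refine ⟨A ∪ B ∪ C, ?_, fun D hD => succ_le_card_inter_union_union hAB.le hABC
    (hint D hD A hA) (hint D hD B hB) (hint D hD C hC)⟩
  have hCAB := succ_le_card_inter_union hAB.le hABC (hint C hC A hA) (hint C hC B hB)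
  have hCle := card_le_card (inter_subset_left (s₁ := C) (s₂ := A ∪ B))
  have hcardAB := card_union_add_card_inter A B
  have hcardABC := card_union_add_card_inter (A ∪ B) C
  rw [inter_comm] at hcardABC
  rw [hr hA, hr hB] at hcardAB
  rw [hr hC] at hcardABC hCle
  omega

theorem exists_card_le_choose_mul_card_starOf {J : Finset α} (hsub : 𝒜 ⊆ F) (hne : 𝒜.Nonempty)
    (hJ : ∀ A ∈ 𝒜, m ≤ #(A ∩ J)) :
    ∃ S : Finset α, #S = m ∧ #𝒜 ≤ (#J).choose m * #(starOf F S) := by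
  have hcover : 𝒜 ⊆ (J.powersetCard m).biUnion (starOf F) := fun A hA => by
    obtain ⟨S, hS, hSm⟩ := exists_subset_card_eq (hJ A hA)
    exact mem_biUnion.2 ⟨S, mem_powersetCard.2 ⟨hS.trans inter_subset_right, hSm⟩,
      mem_starOf.2 ⟨hsub hA, hS.trans inter_subset_left⟩⟩
  have hJm : (J.powersetCard m).Nonempty :=
    (biUnion_nonempty.1 (hne.mono hcover)).imp fun _ h => h.1
  obtain ⟨S, hS, hmax⟩ := exists_max_image (J.powersetCard m) (fun S => #(starOf F S)) hJm
  refine ⟨S, (mem_powersetCard.1 hS).2, (card_le_card hcover).trans ?_⟩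
  rw [← card_powersetCard]
  exact card_biUnion_le_card_mul _ _ _ hmax

theorem IsTIntersecting.exists_subset_starOf_or_card_lt {M : ℕ} (h𝒜 : IsTIntersecting t 𝒜)
    (hr : (F : Set (Finset α)).Sized r) (hsub : 𝒜 ⊆ F)
    (hM : ∀ S, #S = t + 1 → (3 * r - 2 * t - 1).choose (t + 1) * #(starOf F S) < M) :
    (∃ T, #T = t ∧ 𝒜 ⊆ starOf F T) ∨ #𝒜 < M := by
  by_cases hT : ∃ T, #T = t ∧ ∀ A ∈ 𝒜, T ⊆ A
  · obtain ⟨T, hTt, hT𝒜⟩ := hT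
    exact .inl ⟨T, hTt, fun A hA => mem_starOf.2 ⟨hsub hA, hT𝒜 A hA⟩⟩
  push Not at hT
  obtain ⟨J, hJ, hJ𝒜⟩ :=
    h𝒜.exists_card_le_forall_succ_le_card_inter (hr.mono (coe_subset.2 hsub)) hT
  obtain ⟨S, hS, h𝒜S⟩ := exists_card_le_choose_mul_card_starOf hsub h𝒜.1 hJ𝒜
  right
  calc #𝒜 ≤ (#J).choose (t + 1) * #(starOf F S) := h𝒜S
    _ ≤ (3 * r - 2 * t - 1).choose (t + 1) * #(starOf F S) := by gcongr
    _ < M := hM S hS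

theorem isLargestTIntersecting_starOf (hr : (F : Set (Finset α)).Sized r) (hT₀ : #T₀ = t)
    (hne : (starOf F T₀).Nonempty) (hstar : ∀ T, #T = t → #(starOf F T) ≤ #(starOf F T₀))
    (hsmall : ∀ S, #S = t + 1 →
      (3 * r - 2 * t - 1).choose (t + 1) * #(starOf F S) < #(starOf F T₀)) :
    IsLargestTIntersecting F t (starOf F T₀) := by
  refine ⟨⟨starOf_subset, hT₀ ▸ isTIntersecting_starOf hne⟩, fun 𝒜 hsub h𝒜 => ?_⟩
  obtain ⟨T, hT, h𝒜T⟩ | hlt := h𝒜.exists_subset_starOf_or_card_lt hr hsub hsmall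
  · exact (card_le_card h𝒜T).trans (hstar T hT)
  · exact hlt.le

theorem IsLargestTIntersecting.isTStar (h𝒜 : IsLargestTIntersecting F t 𝒜)
    (hr : (F : Set (Finset α)).Sized r) (hT₀ : IsLargestTIntersecting F t (starOf F T₀))
    (hstar : ∀ T, #T = t → #(starOf F T) ≤ #(starOf F T₀))
    (hsmall : ∀ S, #S = t + 1 →
      (3 * r - 2 * t - 1).choose (t + 1) * #(starOf F S) < #(starOf F T₀)) :
    IsTStar F t 𝒜 := by
  obtain ⟨⟨hsub, hint⟩, hmax⟩ := h𝒜
  have hle : #(starOf F T₀) ≤ #𝒜 := hmax _ hT₀.1.1 hT₀.1.2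
  obtain ⟨T, hT, h𝒜T⟩ | hlt := hint.exists_subset_starOf_or_card_lt hr hsub hsmall
  · obtain ⟨B, hB⟩ := hint.1
    exact ⟨T, hT, ⟨B, hsub hB, (mem_starOf.1 (h𝒜T hB)).2⟩,
      eq_of_subset_of_card_le h𝒜T ((hstar T hT).trans hle)⟩
  · exact absurd hlt hle.not_gt

end Families

section Injections

variable {α : Type*}

theorem exists_mapsTo_injOn_of_card_le {s t : Finset α} (h : #s ≤ #t) :
    ∃ f : α → α, Set.MapsTo f s t ∧ Set.InjOn f s := by
  obtain hα | hα := isEmpty_or_nonempty α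
  · exact ⟨id, fun a => hα.elim a, Function.injective_id.injOn⟩
  · have hst : (s : Set α).encard ≤ (t : Set α).encard := by
      simpa only [Set.encard_coe_eq_coe_finsetCard, Nat.cast_le] using h
    obtain ⟨f, hf, hinj⟩ := s.finite_toSet.exists_injOn_of_encard_le hst
    exact ⟨f, hf, hinj⟩

theorem exists_injOn_compl_of_card_eq {X Y : Finset α} (h : #X = #Y) :
    ∃ f : α → α, Set.InjOn f (X : Set α)ᶜ ∧
      ∀ i ∉ X, f i ∉ Y ∧ (f i = i ∨ i ∈ Y ∧ f i ∈ X) := by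
  classical
  obtain ⟨e, he, hinj⟩ := exists_mapsTo_injOn_of_card_le (card_sdiff_comm h).ge
  have he' : ∀ i ∈ Y, i ∉ X → e i ∈ X ∧ e i ∉ Y := fun i hiY hiX =>
    mem_sdiff.1 (he (mem_sdiff.2 ⟨hiY, hiX⟩))
  refine ⟨fun i => if i ∈ Y then e i else i, fun i hi j hj hij => ?_, fun i hi => ?_⟩
  · have hinj' := @hinj i
    grind
  · grind

end Injections

section Rainbow

variable {α ι : Type*} [DecidableEq ι] {c : α → ι} {E E' A B S T T₀ : Finset α} {m r t : ℕ}

/-- The rainbow `r`-subsets of `E` for the coloring `c`: those whose elements have pairwise distinct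
colors, encoded by counting the colors so that membership is decidable. -/
def rainbowSets (c : α → ι) (E : Finset α) (r : ℕ) : Finset (Finset α) :=
  {A ∈ E.powersetCard r | #(A.image c) = r}

/-- The elements of `E` whose color is not used by `T`, that is, those which can be added to a
rainbow set `T` in forming larger rainbow sets. -/
def residual (c : α → ι) (E T : Finset α) : Finset α :=
  {a ∈ E | c a ∉ T.image c}

/-- Every color used by `T` occurs in `E` at most as often as any color of `E` that `T` does not
use. -/
def HasSmallestColors (c : α → ι) (E T : Finset α) : Prop :=
  ∀ i ∈ T.image c, ∀ j ∈ E.image c \ T.image c, #{a ∈ E | c a = i} ≤ #{a ∈ E | c a = j}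

theorem mem_rainbowSets : A ∈ rainbowSets c E r ↔ A ⊆ E ∧ #A = r ∧ Set.InjOn c A := by
  rw [rainbowSets, mem_filter, mem_powersetCard, and_assoc]
  refine and_congr_right fun _ => and_congr_right fun hA => ?_
  rw [← card_image_iff, hA]

theorem sized_rainbowSets : (rainbowSets c E r : Set (Finset α)).Sized r :=
  fun _ hA => (mem_rainbowSets.1 hA).2.1

theorem rainbowSets_mono (hE : E ⊆ E') : rainbowSets c E r ⊆ rainbowSets c E' r := fun _ hA =>
  have ⟨hAE, hA⟩ := mem_rainbowSets.1 hA
  mem_rainbowSets.2 ⟨hAE.trans hE, hA⟩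

theorem mem_rainbowSets_of_subset (hB : B ∈ rainbowSets c E r) (hAB : A ⊆ B) :
    A ∈ rainbowSets c E #A :=
  have ⟨hBE, _, hinj⟩ := mem_rainbowSets.1 hB
  mem_rainbowSets.2 ⟨hAB.trans hBE, rfl, hinj.mono (coe_subset.2 hAB)⟩

theorem card_image_of_mem_rainbowSets (hA : A ∈ rainbowSets c E r) : #(A.image c) = r :=
  (mem_filter.1 hA).2

theorem image_subset_of_mem_rainbowSets (hA : A ∈ rainbowSets c E r) : A.image c ⊆ E.image c :=
  image_subset_image (mem_rainbowSets.1 hA).1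

theorem rainbowSets_nonempty (hr : r ≤ #(E.image c)) : (rainbowSets c E r).Nonempty := by
  obtain ⟨X, hXE, hX⟩ := exists_subset_card_eq hr
  obtain ⟨A, hAE, hinj, rfl⟩ := exists_subset_injOn_image_eq_of_surjOn (f := c) E X
    fun x hx => mem_image.1 (hXE hx)
  exact ⟨A, mem_rainbowSets.2 ⟨coe_subset.1 hAE, by rwa [card_image_of_injOn hinj] at hX, hinj⟩⟩

theorem image_residual : (residual c E T).image c = E.image c \ T.image c := by
  ext x
  grind [residual]

theorem filter_color_residual {i : ι} (hi : i ∉ T.image c) :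
    ({a ∈ residual c E T | c a = i} : Finset α) = {a ∈ E | c a = i} := by
  grind [residual]

theorem card_image_residual (hT : T ∈ rainbowSets c E t) :
    #((residual c E T).image c) = #(E.image c) - t := by
  rw [image_residual, card_sdiff_of_subset (image_subset_of_mem_rainbowSets hT),
    card_image_of_mem_rainbowSets hT]

theorem residual_anti (hST : S ⊆ T) : residual c E T ⊆ residual c E S :=
  monotone_filter_right _ fun _ _ h hS => h (image_subset_image hST hS)

theorem disjoint_of_subset_residual (hA : A ⊆ residual c E T) : Disjoint T A :=
  disjoint_right.2 fun _ ha haT => (mem_filter.1 (hA ha)).2 (mem_image_of_mem c haT)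

theorem insert_mem_rainbowSets [DecidableEq α] {a : α} (hA : A ∈ rainbowSets c E m)
    (ha : a ∈ residual c E A) :
    insert a A ∈ rainbowSets c E (m + 1) := by
  obtain ⟨hAE, hAm, hinj⟩ := mem_rainbowSets.1 hA
  obtain ⟨haE, hac⟩ := mem_filter.1 ha
  have haA : a ∉ A := fun h => hac (mem_image_of_mem c h)
  refine mem_rainbowSets.2 ⟨insert_subset haE hAE, by rw [card_insert_of_notMem haA, hAm], ?_⟩
  rw [coe_insert, Set.injOn_insert (mem_coe.not.2 haA), ← coe_image, mem_coe]
  exact ⟨hinj, hac⟩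

theorem card_image_sub_mul_card_rainbowSets_le :
    (#(E.image c) - m) * #(rainbowSets c E m) ≤ (m + 1) * #(rainbowSets c E (m + 1)) := by
  classical
  rw [mul_comm, mul_comm (m + 1)]
  refine card_mul_le_card_mul (· ⊆ ·) (fun A hA => ?_) fun B hB => ?_
  · calc #(E.image c) - m = #((residual c E A).image c) := (card_image_residual hA).symm
      _ ≤ #(residual c E A) := card_image_le
      _ ≤ _ := card_le_card_of_injOn (insert · A) (fun a ha => mem_coe.2 ?_) ?_
    · exact mem_bipartiteAbove _ |>.2 ⟨insert_mem_rainbowSets hA ha, subset_insert a A⟩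
    · exact (Finset.insert_inj_on A).mono fun a ha =>
        disjoint_right.1 (disjoint_of_subset_residual Subset.rfl) ha
  · calc _ ≤ #(B.powersetCard m) := card_le_card fun A hA => by
          obtain ⟨hA, hAB⟩ := (mem_bipartiteBelow _).1 hA
          exact mem_powersetCard.2 ⟨hAB, sized_rainbowSets hA⟩
      _ = m + 1 := by rw [card_powersetCard, sized_rainbowSets hB, Nat.choose_succ_self_right]

theorem exists_mapsTo_injOn_of_card_color_le {f : ι → ι} (hf : Set.InjOn f (E.image c))
    (hcard : ∀ i ∈ E.image c, #{a ∈ E | c a = i} ≤ #{a ∈ E' | c a = f i}) :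
    ∃ g : α → α, Set.MapsTo g E E' ∧ Set.InjOn g E ∧ Set.EqOn (f ∘ c) (c ∘ g) E := by
  have hclass : ∀ i, ∃ h : α → α, i ∈ E.image c →
      Set.MapsTo h ({a ∈ E | c a = i} : Finset α) ({a ∈ E' | c a = f i} : Finset α) ∧
        Set.InjOn h ({a ∈ E | c a = i} : Finset α) := fun i => by
    by_cases hi : i ∈ E.image c
    · exact (exists_mapsTo_injOn_of_card_le (hcard i hi)).imp fun h hh _ => hh
    · exact ⟨id, fun h => absurd h hi⟩
  choose h hh using hclass
  have hmem : ∀ a ∈ E, h (c a) a ∈ E' ∧ c (h (c a) a) = f (c a) := fun a ha =>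
    mem_filter.1 ((hh (c a) (mem_image_of_mem c ha)).1 (mem_coe.2 (mem_filter.2 ⟨ha, rfl⟩)))
  refine ⟨fun a => h (c a) a, fun a ha => (hmem a ha).1, fun a ha b hb hab => ?_,
    fun a ha => (hmem a ha).2.symm⟩
  have hcab : c a = c b := hf (mem_image_of_mem c ha) (mem_image_of_mem c hb)
    ((hmem a ha).2.symm.trans ((congrArg c hab).trans (hmem b hb).2))
  refine (hh (c a) (mem_image_of_mem c ha)).2 (by simpa using ha) (by simpa [hcab] using hb) ?_
  simpa only [hcab] using hab

theorem card_rainbowSets_le_of_injOn {f : ι → ι} (hf : Set.InjOn f (E.image c))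
    (hcard : ∀ i ∈ E.image c, #{a ∈ E | c a = i} ≤ #{a ∈ E' | c a = f i}) :
    #(rainbowSets c E m) ≤ #(rainbowSets c E' m) := by
  classical
  obtain ⟨g, hgE', hg, hcg⟩ := exists_mapsTo_injOn_of_card_color_le hf hcard
  have hsubset : ∀ A ∈ rainbowSets c E m, (A : Set α) ⊆ E := fun A hA =>
    coe_subset.2 (mem_rainbowSets.1 hA).1
  refine card_le_card_of_injOn (·.image g) (fun A hA => mem_coe.2 ?_) fun A hA B hB hAB => ?_
  · obtain ⟨hAE, hAm, hinj⟩ := mem_rainbowSets.1 hA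
    have hcolors : Set.InjOn (f ∘ c) A := hf.comp hinj fun a ha =>
      mem_coe.2 (mem_image_of_mem c (hAE ha))
    refine mem_rainbowSets.2 ⟨image_subset_iff.2 fun a ha => hgE' (hAE ha),
      by rw [card_image_of_injOn (hg.mono (hsubset A hA)), hAm], ?_⟩
    rw [coe_image]
    exact (hcolors.congr (hcg.mono (hsubset A hA))).image_of_comp
  · rw [← coe_inj, ← hg.image_eq_image_iff (hsubset A hA) (hsubset B hB), ← coe_image, ← coe_image]
    exact congrArg _ hAB

variable [DecidableEq α]

theorem sdiff_mem_rainbowSets_residual (hA : A ∈ rainbowSets c E r) (hTA : T ⊆ A) :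
    A \ T ∈ rainbowSets c (residual c E T) (r - #T) := by
  obtain ⟨hAE, rfl, hinj⟩ := mem_rainbowSets.1 hA
  refine mem_rainbowSets.2 ⟨fun a ha => ?_, card_sdiff_of_subset hTA,
    hinj.mono (coe_subset.2 sdiff_subset)⟩
  obtain ⟨haA, haT⟩ := mem_sdiff.1 ha
  refine mem_filter.2 ⟨hAE haA, fun hac => haT ?_⟩
  obtain ⟨b, hb, hba⟩ := mem_image.1 hac
  exact hinj (hTA hb) haA hba ▸ hb

theorem union_mem_rainbowSets (hT : T ∈ rainbowSets c E t)
    (hA : A ∈ rainbowSets c (residual c E T) m) : T ∪ A ∈ rainbowSets c E (t + m) := by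
  obtain ⟨hTE, rfl, hTinj⟩ := mem_rainbowSets.1 hT
  obtain ⟨hAE, rfl, hAinj⟩ := mem_rainbowSets.1 hA
  have hdisj := disjoint_of_subset_residual hAE
  refine mem_rainbowSets.2 ⟨union_subset hTE (hAE.trans (filter_subset _ _)),
    card_union_of_disjoint hdisj, ?_⟩
  rw [coe_union, Set.injOn_union (disjoint_coe.2 hdisj)]
  exact ⟨hTinj, hAinj, fun b hb a ha hba =>
    (mem_filter.1 (hAE ha)).2 (hba ▸ mem_image_of_mem c hb)⟩

theorem card_starOf_rainbowSets (hT : T ∈ rainbowSets c E t) (htr : t ≤ r) :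
    #(starOf (rainbowSets c E r) T) = #(rainbowSets c (residual c E T) (r - t)) := by
  refine card_nbij' (· \ T) (T ∪ ·) (fun A hA => ?_) (fun A hA => ?_) (fun A hA => ?_)
    fun A hA => ?_
  · obtain ⟨hA, hTA⟩ := mem_starOf.1 hA
    rw [← sized_rainbowSets hT]
    exact sdiff_mem_rainbowSets_residual hA hTA
  · have hTA := union_mem_rainbowSets hT hA
    rw [Nat.add_sub_cancel' htr] at hTA
    exact mem_starOf.2 ⟨hTA, subset_union_left⟩
  · exact union_sdiff_of_subset (mem_starOf.1 hA).2
  · exact union_sdiff_cancel_left (disjoint_of_subset_residual (mem_rainbowSets.1 hA).1)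

theorem starOf_rainbowSets_nonempty (hT : T ∈ rainbowSets c E t) (htr : t ≤ r)
    (hr : r ≤ #(E.image c)) : (starOf (rainbowSets c E r) T).Nonempty := by
  rw [← card_pos, card_starOf_rainbowSets hT htr, card_pos]
  refine rainbowSets_nonempty ?_
  rw [card_image_residual hT]
  exact Nat.sub_le_sub_right hr t

theorem card_image_add_one_sub_mul_card_starOf_le (hS : #S = t + 1) {a : α} (ha : a ∈ S) :
    (#(E.image c) + 1 - r) * #(starOf (rainbowSets c E r) S) ≤
      (r - t) * #(starOf (rainbowSets c E r) (S.erase a)) := by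
  obtain hempty | ⟨B, hB⟩ := (starOf (rainbowSets c E r) S).eq_empty_or_nonempty
  · simp [hempty]
  obtain ⟨hB, hSB⟩ := mem_starOf.1 hB
  have hSr : t + 1 ≤ r := hS ▸ sized_rainbowSets hB ▸ card_le_card hSB
  obtain ⟨m, rfl⟩ := Nat.exists_eq_add_of_le hSr
  have hS' : S ∈ rainbowSets c E (t + 1) := hS ▸ mem_rainbowSets_of_subset hB hSB
  have hSa : S.erase a ∈ rainbowSets c E t := by
    simpa [card_erase_of_mem ha, hS] using mem_rainbowSets_of_subset hS' (erase_subset a S)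
  have hcolors : #(E.image c) + 1 - (t + 1 + m) = #((residual c E (S.erase a)).image c) - m := by
    rw [card_image_residual hSa]
    omega
  rw [card_starOf_rainbowSets hS' hSr, card_starOf_rainbowSets hSa (by omega), hcolors,
    Nat.add_sub_cancel_left, add_assoc, Nat.add_sub_cancel_left, add_comm 1 m]
  calc _ ≤ (#((residual c E (S.erase a)).image c) - m) *
        #(rainbowSets c (residual c E (S.erase a)) m) :=
      Nat.mul_le_mul_left _ (card_le_card (rainbowSets_mono (residual_anti (erase_subset a S))))
    _ ≤ _ := card_image_sub_mul_card_rainbowSets_le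

theorem card_starOf_rainbowSets_le (hT : #T = t) (hT₀ : T₀ ∈ rainbowSets c E t)
    (hmin : HasSmallestColors c E T₀) :
    #(starOf (rainbowSets c E r) T) ≤ #(starOf (rainbowSets c E r) T₀) := by
  obtain hempty | ⟨B, hB⟩ := (starOf (rainbowSets c E r) T).eq_empty_or_nonempty
  · simp [hempty]
  obtain ⟨hB, hTB⟩ := mem_starOf.1 hB
  have htr : t ≤ r := hT ▸ sized_rainbowSets hB ▸ card_le_card hTB
  have hT : T ∈ rainbowSets c E t := hT ▸ mem_rainbowSets_of_subset hB hTB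
  have hcolors : #(T.image c) = #(T₀.image c) := by
    rw [card_image_of_mem_rainbowSets hT, card_image_of_mem_rainbowSets hT₀]
  obtain ⟨f, hf, hfT⟩ := exists_injOn_compl_of_card_eq hcolors
  rw [card_starOf_rainbowSets hT htr, card_starOf_rainbowSets hT₀ htr]
  refine card_rainbowSets_le_of_injOn (hf.mono fun i hi => ?_) fun i hi => ?_
  · rw [image_residual] at hi
    exact (mem_sdiff.1 hi).2
  rw [image_residual, mem_sdiff] at hi
  obtain ⟨hfi, hfi' | ⟨hi₀, hfi'⟩⟩ := hfT i hi.2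
  all_goals rw [filter_color_residual hi.2, filter_color_residual hfi]
  · rw [hfi']
  · exact hmin i hi₀ (f i) (mem_sdiff.2 ⟨image_subset_of_mem_rainbowSets hT hfi', hfi⟩)

theorem choose_mul_card_starOf_rainbowSets_lt (htr : t ≤ r)
    (hE : (r - t) * (3 * r - 2 * t - 1).choose (t + 1) + r ≤ #(E.image c))
    (hT₀ : T₀ ∈ rainbowSets c E t)
    (hstar : ∀ T, #T = t → #(starOf (rainbowSets c E r) T) ≤ #(starOf (rainbowSets c E r) T₀))
    (hS : #S = t + 1) :
    (3 * r - 2 * t - 1).choose (t + 1) * #(starOf (rainbowSets c E r) S) <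
      #(starOf (rainbowSets c E r) T₀) := by
  have hpos : 0 < #(starOf (rainbowSets c E r) T₀) :=
    (starOf_rainbowSets_nonempty hT₀ htr (le_of_add_le_right hE)).card_pos
  have hfactor : (#(E.image c) + 1 - r) * #(starOf (rainbowSets c E r) S) ≤
      (r - t) * #(starOf (rainbowSets c E r) T₀) := by
    obtain ⟨a, ha⟩ : S.Nonempty := card_pos.1 (by omega)
    exact (card_image_add_one_sub_mul_card_starOf_le hS ha).trans
      (Nat.mul_le_mul_left _ (hstar _ (by rw [card_erase_of_mem ha, hS, Nat.add_sub_cancel])))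
  generalize #(starOf (rainbowSets c E r) S) = s, #(starOf (rainbowSets c E r) T₀) = s₀,
    (3 * r - 2 * t - 1).choose (t + 1) = b at *
  refine lt_of_mul_lt_mul_left (a := #(E.image c) + 1 - r) ?_ (Nat.zero_le _)
  calc (#(E.image c) + 1 - r) * (b * s) = b * ((#(E.image c) + 1 - r) * s) := mul_left_comm _ _ _
    _ ≤ b * ((r - t) * s₀) := Nat.mul_le_mul_left b hfactor
    _ = (r - t) * b * s₀ := by ring
    _ < (#(E.image c) + 1 - r) * s₀ := Nat.mul_lt_mul_of_pos_right (by omega) hpos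

end Rainbow

section Labeled

variable {n r t : ℕ} {k : ℕ → ℕ}

/-- The pairs `(x, y)` with `x ∈ {1, …, n}` and `y ∈ {1, …, k x}`, from which labeled sets are
formed. -/
def labeledPairs (n : ℕ) (k : ℕ → ℕ) : Finset (ℕ × ℕ) :=
  (Icc 1 n).biUnion fun x => (Icc 1 (k x)).image (Prod.mk x)

theorem mem_labeledPairs {p : ℕ × ℕ} :
    p ∈ labeledPairs n k ↔ p.1 ∈ Icc 1 n ∧ p.2 ∈ Icc 1 (k p.1) := by
  simp only [labeledPairs, mem_biUnion, mem_image]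
  constructor
  · rintro ⟨x, hx, y, hy, rfl⟩
    exact ⟨hx, hy⟩
  · exact fun ⟨hx, hy⟩ => ⟨p.1, hx, p.2, hy, rfl⟩

theorem labeledSets_eq_rainbowSets :
    labeledSets n k r = rainbowSets Prod.fst (labeledPairs n k) r := by
  ext A
  rw [mem_labeledSets, mem_rainbowSets]
  constructor
  · rintro ⟨X, hX, rfl, y, hy, rfl⟩
    refine ⟨image_subset_iff.2 fun x hx => mem_labeledPairs.2 ⟨hX hx, hy x hx⟩,
      card_image_of_injective _ fun a b h => congrArg Prod.fst h, ?_⟩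
    rw [coe_image]
    exact Set.InjOn.image_of_comp Function.injective_id.injOn
  · rintro ⟨hA, rfl, hinj⟩
    have hlabel : ∀ x ∈ A.image Prod.fst, ∃ y, (x, y) ∈ A := fun x hx => by simpa using hx
    choose! y hy using hlabel
    refine ⟨A.image Prod.fst, fun x hx => (mem_labeledPairs.1 (hA (hy x hx))).1,
      card_image_of_injOn hinj, y, fun x hx => (mem_labeledPairs.1 (hA (hy x hx))).2, ?_⟩
    have hA' : ∀ p ∈ A, (p.1, y p.1) = p := fun p hp =>
      hinj (hy _ (mem_image_of_mem _ hp)) hp rfl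
    rw [image_image]
    exact (image_id.symm.trans (image_congr fun p hp => (hA' p hp).symm))

theorem card_image_fst_labeledPairs (hk : ∀ i ∈ Set.Icc 1 n, 1 ≤ k i) :
    #((labeledPairs n k).image Prod.fst) = n := by
  have hbase : (labeledPairs n k).image Prod.fst = Icc 1 n := by
    refine Subset.antisymm (image_subset_iff.2 fun p hp => (mem_labeledPairs.1 hp).1) fun x hx => ?_
    exact mem_image.2 ⟨(x, 1), mem_labeledPairs.2
      ⟨hx, mem_Icc.2 ⟨le_rfl, hk x (mem_Icc.1 hx)⟩⟩, rfl⟩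
  rw [hbase, Nat.card_Icc, Nat.add_sub_cancel]

theorem card_filter_fst_labeledPairs {i : ℕ} (hi : i ∈ Icc 1 n) :
    #{p ∈ labeledPairs n k | p.1 = i} = k i := by
  have hclass : ({p ∈ labeledPairs n k | p.1 = i} : Finset (ℕ × ℕ)) =
      (Icc 1 (k i)).image (Prod.mk i) := by
    grind [mem_labeledPairs]
  rw [hclass, card_image_of_injective _ (Prod.mk_right_injective i), Nat.card_Icc,
    Nat.add_sub_cancel]

theorem image_mk_one_mem_labeledSets (hk : ∀ i ∈ Set.Icc 1 n, 1 ≤ k i) (htn : t ≤ n) :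
    ((Icc 1 t).image fun i => (i, 1)) ∈ labeledSets n k t :=
  have hsub : Icc 1 t ⊆ Icc 1 n := Icc_subset_Icc_right htn
  mem_labeledSets.2 ⟨Icc 1 t, hsub, Nat.card_Icc 1 t, fun _ => 1,
    fun i hi => mem_Icc.2 ⟨le_rfl, hk i (mem_Icc.1 (hsub hi))⟩, rfl⟩

theorem hasSmallestColors_image_mk_one (hk : MonotoneOn k (Set.Icc 1 n)) :
    HasSmallestColors Prod.fst (labeledPairs n k) ((Icc 1 t).image fun i => (i, 1)) := by
  have hbase : ((Icc 1 t).image fun i => (i, 1)).image Prod.fst = Icc 1 t := by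
    rw [image_image]
    exact image_id
  intro i hi j hj
  rw [hbase] at hi hj
  obtain ⟨hj, hjt⟩ := mem_sdiff.1 hj
  obtain ⟨p, hp, rfl⟩ := mem_image.1 hj
  have hpn := (mem_labeledPairs.1 hp).1
  rw [mem_Icc] at hi hjt hpn
  have hin : 1 ≤ i ∧ i ≤ n := by omega
  rw [card_filter_fst_labeledPairs (mem_Icc.2 hin), card_filter_fst_labeledPairs (mem_Icc.2 hpn)]
  exact hk hin hpn (by omega)

end Labeled

end LabeledSets

open LabeledSets in
theorem mainTheorem2_general {α ι : Type*} [DecidableEq α] [DecidableEq ι] {t r : ℕ} (htr : t ≤ r)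
    {c : α → ι} {E T₀ : Finset α}
    (hE : (r - t) * (3 * r - 2 * t - 1).choose (t + 1) + r ≤ (E.image c).card)
    (hT₀ : T₀ ∈ rainbowSets c E t)
    (hmin : HasSmallestColors c E T₀) :
    HasTStarPropertyAt (rainbowSets c E r) t T₀ ∧ HasStrictTStarProperty (rainbowSets c E r) t := by
  have hstar := fun T (hT : Finset.card T = t) => card_starOf_rainbowSets_le (r := r) hT hT₀ hmin
  have hsmall := fun S (hS : Finset.card S = t + 1) =>
    choose_mul_card_starOf_rainbowSets_lt htr hE hT₀ hstar hS
  have hne := starOf_rainbowSets_nonempty hT₀ htr (le_of_add_le_right hE)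
  have hlargest :=
    isLargestTIntersecting_starOf sized_rainbowSets (sized_rainbowSets hT₀) hne hstar hsmall
  exact ⟨⟨sized_rainbowSets hT₀, hlargest⟩,
    .inr fun 𝒜 h𝒜 => h𝒜.isTStar sized_rainbowSets hlargest hstar hsmall⟩

theorem mainTheorem2 (t r n : ℕ) (ht : 1 ≤ t) (htr : t ≤ r)
    (hn : (r - t) * Nat.choose (3 * r - 2 * t - 1) (t + 1) + r ≤ n)
    (k : ℕ → ℕ) (hk_pos : ∀ i ∈ Set.Icc 1 n, 1 ≤ k i) (hk_mono : MonotoneOn k (Set.Icc 1 n)) :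
    LabeledSets.HasTStarPropertyAt (LabeledSets.labeledSets n k r) t
        ((Finset.Icc 1 t).image fun i => (i, 1)) ∧
      LabeledSets.HasStrictTStarProperty (LabeledSets.labeledSets n k r) t := by
  have hT₀ := LabeledSets.image_mk_one_mem_labeledSets hk_pos (htr.trans (le_of_add_le_right hn))
  rw [LabeledSets.labeledSets_eq_rainbowSets] at hT₀ ⊢
  exact mainTheorem2_general htr
    (hn.trans_eq (LabeledSets.card_image_fst_labeledPairs hk_pos).symm) hT₀
    (LabeledSets.hasSmallestColors_image_mk_one hk_mono)
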